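/- \textbf{Theorem (universality of normalized DeepSets).} Let $k\in\mathbb N$, $p\in[1,\infty)$, and let $\|\cdot\|$ be an arbitrary norm on $\mathbb R^k$. Let $\mathcal P_p(\mathbb R^k)$ be the set of Borel probability measures $\mu$ on $\mathbb R^k$ with $\int\|x\|^p\,d\mu<\infty$, endowed with the topology of the Wasserstein distance $W_p(\mu,\nu)=\inf_{\pi}\big(\int\|x-y\|^p\,d\pi(x,y)\big)^{1/p}$, the infimum being over all couplings $\pi$ of $\mu$ and $\nu$. For $\phi:\mathbb R\to\mathbb R$ and $n,m\in\mathbb N$, let $\mathtt{NN}^\phi_{n,m}$ be the set of all maps $\mathbb R^m\to\mathbb R^n$ of the form $x\mapsto W_2\,\phi(W_1x+\theta_1)+\theta_2$ with $W_1\in\mathbb R^{s\times m}$, $\theta_1\in\mathbb R^s$, $W_2\in\mathbb R^{n\times s}$, $\theta_2\in\mathbb R^n$ and any width $s\ge 1$, where $\phi$ is applied to each coordinate. Suppose that $\phi$ is Lipschitz continuous, is not a polynomial, and is asymptotically polynomial at $\pm\infty$: there are polynomials $P_+,P_-$ (possibly constant) such that $\phi(t)/P_\pm(t)\to1$ as $t\to\pm\infty$,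 respectively, where for $P_\pm=0$ this condition is read as $\phi(t)\to 0$. Let $Q\subseteq\mathcal P_p(\mathbb R^k)$ be compact. Then, for all $r\ge1$, $\rho\in\mathtt{NN}^\phi_{r,k}$ and $\sigma\in\mathtt{NN}^\phi_{1,r}$, the map $\rho$ is integrable with respect to every $\mu\in Q$ and the map $\mu\mapsto\sigma\big(\int\rho\,d\mu\big)$ is continuous on $Q$; and the set $$\Big\{\,\mu\mapsto\sigma\Big(\int\rho\,d\mu\Big)\ \Big|\ r\ge1,\ \rho\in\mathtt{NN}^\phi_{r,k},\ \sigma\in\mathtt{NN}^\phi_{1,r}\Big\}$$ of functions on $Q$ is dense in $C(Q)$, the space of continuous real-valued functions on $Q$ with the supremum norm. -/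

import Mathlib

open MeasureTheory Filter Topology
open scoped ENNReal NNReal Matrix

/-- `P_p(ℝ^k)`: Borel probability measures on `ℝ^k` with finite `p`-th moment with respect to
the norm `nrm`. This is a structure of its own, so that it does not inherit the topology of weak
convergence; its topology is the one of the Wasserstein distance, below. -/
structure WassersteinSpace {k : ℕ} (nrm : Seminorm ℝ (Fin k → ℝ)) (p : ℝ) where
  toMeasure : Measure (Fin k → ℝ)
  isProbabilityMeasure : IsProbabilityMeasure toMeasure
  finite_moment : ∫⁻ x, ENNReal.ofReal (nrm x) ^ p ∂toMeasure < ∞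

namespace WassersteinSpace

variable {k : ℕ} {nrm : Seminorm ℝ (Fin k → ℝ)} {p : ℝ}

/-- The couplings of `μ` and `ν`: measures on the product with marginals `μ` and `ν`. -/
def couplings (μ ν : WassersteinSpace nrm p) : Set (Measure ((Fin k → ℝ) × (Fin k → ℝ))) :=
  {π | π.map Prod.fst = μ.toMeasure ∧ π.map Prod.snd = ν.toMeasure}

/-- The Wasserstein distance `W_p(μ, ν) = (inf_π ∫ ‖x - y‖^p dπ(x, y))^(1/p)`, the infimum being
over all couplings `π` of `μ` and `ν`. -/
noncomputable def dist (μ ν : WassersteinSpace nrm p) : ℝ≥0∞ :=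
  (⨅ π ∈ couplings μ ν, ∫⁻ z, ENNReal.ofReal (nrm (z.1 - z.2)) ^ p ∂π) ^ (1 / p)

/-- The topology of the Wasserstein distance: a set is open iff it contains, with each of its
points `μ`, a ball `{ν | W_p(μ, ν) < ε}` with `ε > 0`. -/
instance : TopologicalSpace (WassersteinSpace nrm p) where
  IsOpen U := ∀ μ ∈ U, ∃ ε : ℝ≥0∞, 0 < ε ∧ ∀ ν, dist μ ν < ε → ν ∈ U
  isOpen_univ := fun _ _ => ⟨1, one_pos, fun _ _ => trivial⟩
  isOpen_inter := by
    rintro U V hU hV μ ⟨hμU, hμV⟩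
    obtain ⟨a, ha, ha'⟩ := hU μ hμU
    obtain ⟨b, hb, hb'⟩ := hV μ hμV
    exact ⟨min a b, lt_min ha hb, fun ν hν =>
      ⟨ha' ν (hν.trans_le (min_le_left a b)), hb' ν (hν.trans_le (min_le_right a b))⟩⟩
  isOpen_sUnion := by
    rintro S hS μ ⟨U, hU, hμ⟩
    obtain ⟨ε, hε, h⟩ := hS U hU μ hμ
    exact ⟨ε, hε, fun ν hν => ⟨U, hU, h ν hν⟩⟩

end WassersteinSpace

/-- The fully connected networks with one hidden layer `x ↦ W₂ φ(W₁ x + θ₁) + θ₂` from `ℝ^m` to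
`ℝ^n`, of arbitrary width `r ≥ 1`, with the activation `φ` applied to each coordinate. -/
def NN (φ : ℝ → ℝ) (n m : ℕ) : Set ((Fin m → ℝ) → (Fin n → ℝ)) :=
  {f | ∃ r : ℕ, 1 ≤ r ∧ ∃ (W₁ : Matrix (Fin r) (Fin m) ℝ) (θ₁ : Fin r → ℝ)
    (W₂ : Matrix (Fin n) (Fin r) ℝ) (θ₂ : Fin n → ℝ),
    f = fun x => W₂ *ᵥ (fun i => φ ((W₁ *ᵥ x + θ₁) i)) + θ₂}

/-- The normalized DeepSets model `μ ↦ σ (∫ ρ dμ)`; the output space `ℝ^1` of `σ` is identified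
with `ℝ`. -/
noncomputable def normalizedDeepSets {k : ℕ} {nrm : Seminorm ℝ (Fin k → ℝ)} {p : ℝ} {r : ℕ}
    (ρ : (Fin k → ℝ) → (Fin r → ℝ)) (σ : (Fin r → ℝ) → (Fin 1 → ℝ))
    (μ : WassersteinSpace nrm p) : ℝ :=
  σ (∫ x, ρ x ∂μ.toMeasure) 0

/-- The class of all normalized DeepSets models with `ρ` and `σ` networks with activation `φ`. -/
def normalizedDeepSetsClass (φ : ℝ → ℝ) {k : ℕ} (nrm : Seminorm ℝ (Fin k → ℝ)) (p : ℝ) :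
    Set (WassersteinSpace nrm p → ℝ) :=
  {F | ∃ r : ℕ, 1 ≤ r ∧ ∃ ρ ∈ NN φ r k, ∃ σ ∈ NN φ 1 r, F = normalizedDeepSets ρ σ}

/-- `φ` is asymptotic to the polynomial `P` along `l`, that is `φ / P → 1`; for the zero
polynomial, where the quotient makes no sense, this means `φ → 0`. -/
def AsymptoticTo (φ : ℝ → ℝ) (P : Polynomial ℝ) (l : Filter ℝ) : Prop :=
  (P ≠ 0 ∧ Tendsto (fun t => φ t / P.eval t) l (𝓝 1)) ∨ (P = 0 ∧ Tendsto φ l (𝓝 0))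

/-- `φ` is asymptotically polynomial at `±∞`. -/
def AsymptoticallyPolynomial (φ : ℝ → ℝ) : Prop :=
  (∃ P : Polynomial ℝ, AsymptoticTo φ P atTop) ∧ (∃ P : Polynomial ℝ, AsymptoticTo φ P atBot)

/-!
The models `μ ↦ σ (∫ ρ dμ)` contain the linear span of the functions `μ ↦ φ (∫ f dμ)`, where `f`
ranges over the linear span of the ridge functions `x ↦ φ (a ⬝ x + b)`
(`mem_normalizedDeepSetsClass_of_mem_span`). The proof that this span is dense rests on one
approximation result on the line: `cos_mem_weightedClosure` says that, if `φ` is Lipschitz and not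
affine, every cosine is approximated by linear combinations of the functions `t ↦ φ (a t + b)` with
an error of at most `ε (1 + |t|)`. It is used twice.

* Since measures in the Wasserstein space have finite first moments, the linear weight is
  integrable, and two measures with the same integrals of ridge functions have the same
  characteristic function, so they agree (`WassersteinSpace.eq_of_forall_mem_ridgeSpan`). Hence the
  functions `μ ↦ cos (∫ f dμ)` separate the points of `Q`. Their span is a subalgebra by the product
  formula for cosines, so it is dense by the Stone–Weierstrass theorem.
* On `Q` the continuous function `μ ↦ ∫ f dμ` is bounded, so that `μ ↦ cos (∫ f dμ)` is a uniform
  limit of linear combinations of the functions `μ ↦ φ (a ∫ f dμ + b)`.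

For the approximation of cosines, take a third difference `D` of `φ` that does not vanish
identically; there is one because a Lipschitz function whose third differences vanish is affine
(`exists_affine_of_third_difference_eq_zero`). It is bounded and has a bounded second
antiderivative, so that integration by parts shows that an average `G t = ∫ c(a) D(a t) da` over
dilations, with a smooth compactly supported weight `c`, is `O(1 / t²)`, hence integrable; for a
suitable `c` it is not zero (`exists_integrable_mem_weightedClosure`). Its Fourier transform is then
nonzero at some frequency `ω ≠ 0`, and modulating the translates of `t ↦ G (α t)` at this frequency
gives all cosines of frequency `α ω`. The averages involved are limits of Riemann sums in the
weighted norm (`integral_mem_weightedClosure`).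
-/

/-! ### Approximation on the line with linear weight -/

/-- The linear span of all dilates and translates `t ↦ φ (a t + b)` of `φ`. -/
def dilationSpan (φ : ℝ → ℝ) : Submodule ℝ (ℝ → ℝ) :=
  Submodule.span ℝ (Set.range fun q : ℝ × ℝ => fun t => φ (q.1 * t + q.2))

/-- The functions on the line that can be approximated by elements of `V` with an error of at most
`ε (1 + |t|)` at `t`, for every `ε > 0`. -/
def weightedClosure (V : Submodule ℝ (ℝ → ℝ)) : Submodule ℝ (ℝ → ℝ) where
  carrier := {f | ∀ ε > 0, ∃ g ∈ V, ∀ t, |f t - g t| ≤ ε * (1 + |t|)}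
  zero_mem' := fun ε hε => ⟨0, V.zero_mem, fun t => by simp; positivity⟩
  add_mem' := by
    intro f₁ f₂ h₁ h₂ ε hε
    obtain ⟨g₁, hg₁, h₁⟩ := h₁ (ε / 2) (by positivity)
    obtain ⟨g₂, hg₂, h₂⟩ := h₂ (ε / 2) (by positivity)
    refine ⟨g₁ + g₂, V.add_mem hg₁ hg₂, fun t => ?_⟩
    calc |(f₁ + f₂) t - (g₁ + g₂) t| = |(f₁ t - g₁ t) + (f₂ t - g₂ t)| := by
          simp only [Pi.add_apply]; ring_nf
      _ ≤ |f₁ t - g₁ t| + |f₂ t - g₂ t| := abs_add_le _ _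
      _ ≤ ε * (1 + |t|) := by linarith [h₁ t, h₂ t]
  smul_mem' := by
    intro c f h ε hε
    obtain ⟨g, hg, h⟩ := h (ε / (|c| + 1)) (by positivity)
    refine ⟨c • g, V.smul_mem c hg, fun t => ?_⟩
    calc |(c • f) t - (c • g) t| = |c| * |f t - g t| := by
          simp only [Pi.smul_apply, smul_eq_mul, ← mul_sub, abs_mul]
      _ ≤ (|c| + 1) * (ε / (|c| + 1) * (1 + |t|)) := by
          gcongr
          · linarith
          · exact h t
      _ = ε * (1 + |t|) := by field_simp

lemma mem_weightedClosure {V : Submodule ℝ (ℝ → ℝ)} {f : ℝ → ℝ} :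
    f ∈ weightedClosure V ↔ ∀ ε > 0, ∃ g ∈ V, ∀ t, |f t - g t| ≤ ε * (1 + |t|) := Iff.rfl

lemma le_weightedClosure (V : Submodule ℝ (ℝ → ℝ)) : V ≤ weightedClosure V :=
  fun f hf ε hε => ⟨f, hf, fun t => by simp; positivity⟩

lemma weightedClosure_idem {V : Submodule ℝ (ℝ → ℝ)} {f : ℝ → ℝ}
    (hf : f ∈ weightedClosure (weightedClosure V)) : f ∈ weightedClosure V := by
  intro ε hε
  obtain ⟨g, hg, h⟩ := hf (ε / 2) (by positivity)
  obtain ⟨g', hg', h'⟩ := hg (ε / 2) (by positivity)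
  exact ⟨g', hg', fun t => by linarith [h t, h' t, abs_sub_le (f t) (g t) (g' t)]⟩

lemma comp_affine_mem_dilationSpan {φ f : ℝ → ℝ} (hf : f ∈ dilationSpan φ) (α β : ℝ) :
    (fun t => f (α * t + β)) ∈ dilationSpan φ := by
  induction hf using Submodule.span_induction with
  | mem x h =>
    obtain ⟨⟨a, b⟩, rfl⟩ := h
    refine Submodule.subset_span ⟨(a * α, a * β + b), ?_⟩
    funext t
    dsimp only
    ring_nf
  | zero => exact (dilationSpan φ).zero_mem
  | add x y _ _ hx hy => exact (dilationSpan φ).add_mem hx hy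
  | smul c x _ hx => exact (dilationSpan φ).smul_mem c hx

lemma comp_affine_mem_weightedClosure {φ f : ℝ → ℝ} (hf : f ∈ weightedClosure (dilationSpan φ))
    (α β : ℝ) : (fun t => f (α * t + β)) ∈ weightedClosure (dilationSpan φ) := by
  intro ε hε
  obtain ⟨g, hg, h⟩ := hf (ε / (1 + |α| + |β|)) (by positivity)
  refine ⟨_, comp_affine_mem_dilationSpan hg α β, fun t => (h _).trans ?_⟩
  have h1 : |α * t + β| ≤ |α| * |t| + |β| := (abs_add_le _ _).trans (by rw [abs_mul])
  calc ε / (1 + |α| + |β|) * (1 + |α * t + β|)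
      ≤ ε / (1 + |α| + |β|) * ((1 + |α| + |β|) * (1 + |t|)) := by
        gcongr
        nlinarith [abs_nonneg α, abs_nonneg β, abs_nonneg t,
          mul_nonneg (abs_nonneg β) (abs_nonneg t)]
    _ = ε * (1 + |t|) := by field_simp

/-- Averages over a parameter stay in the weighted closure, provided that the family is Lipschitz
in the parameter with respect to the weight: the Riemann sums converge. -/
lemma integral_mem_weightedClosure {V : Submodule ℝ (ℝ → ℝ)} {F : ℝ → ℝ → ℝ} {a b C : ℝ}
    (hab : a ≤ b) (hC : 0 ≤ C) (hF : ∀ y, F y ∈ weightedClosure V)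
    (hLip : ∀ y ∈ Set.Icc a b, ∀ y' ∈ Set.Icc a b, ∀ t,
      |F y t - F y' t| ≤ C * |y - y'| * (1 + |t|)) :
    (fun t => ∫ y in a..b, F y t) ∈ weightedClosure V := by
  apply weightedClosure_idem
  intro ε hε
  obtain ⟨N, hN⟩ := exists_nat_gt (C * (b - a) * (b - a) / ε)
  have hN0 : (0 : ℝ) < N := lt_of_le_of_lt
    (div_nonneg (mul_nonneg (mul_nonneg hC (sub_nonneg.2 hab)) (sub_nonneg.2 hab)) hε.le) hN
  set δ : ℝ := (b - a) / N with hδ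
  have hδ0 : 0 ≤ δ := div_nonneg (sub_nonneg.2 hab) hN0.le
  have hNδ : N * δ = b - a := by rw [hδ]; field_simp
  set y : ℕ → ℝ := fun i => a + i * δ with hy
  have hymem : ∀ i ≤ N, y i ∈ Set.Icc a b := by
    intro i hi
    have h2 : (i : ℝ) ≤ N := by exact_mod_cast hi
    refine ⟨by simp only [hy]; nlinarith [mul_nonneg (Nat.cast_nonneg (α := ℝ) i) hδ0], ?_⟩
    simp only [hy]
    nlinarith [mul_le_mul_of_nonneg_right h2 hδ0]
  have hysucc : ∀ i, y (i + 1) = y i + δ := by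
    intro i; simp only [hy]; push_cast; ring
  refine ⟨∑ i ∈ Finset.range N, δ • F (y i), Submodule.sum_mem _ fun i _ =>
    Submodule.smul_mem _ _ (hF _), fun t => ?_⟩
  have hcont : ContinuousOn (fun y => F y t) (Set.Icc a b) := by
    have : LipschitzOnWith (Real.toNNReal (C * (1 + |t|))) (fun y => F y t) (Set.Icc a b) := by
      apply LipschitzOnWith.of_dist_le_mul
      intro u hu v hv
      rw [Real.dist_eq, Real.dist_eq, Real.coe_toNNReal _ (by positivity)]
      exact (hLip u hu v hv t).trans (by ring_nf; rfl)
    exact this.continuousOn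
  have hint : ∀ i < N, IntervalIntegrable (fun y => F y t) volume (y i) (y (i + 1)) := by
    intro i hi
    apply ContinuousOn.intervalIntegrable
    apply hcont.mono
    exact Set.uIcc_subset_Icc (hymem i hi.le) (hymem (i + 1) hi)
  have hsum := intervalIntegral.sum_integral_adjacent_intervals hint
  have hy0 : y 0 = a := by simp [hy]
  have hyN : y N = b := by simp only [hy]; linarith
  rw [hy0, hyN] at hsum
  have hpiece : ∀ i ∈ Finset.range N,
      |(∫ u in (y i)..(y (i + 1)), F u t) - δ * F (y i) t| ≤ C * δ * (1 + |t|) * δ := by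
    intro i hi
    have hi := Finset.mem_range.1 hi
    have h1 : (∫ u in (y i)..(y (i + 1)), F u t) - δ * F (y i) t
        = ∫ u in (y i)..(y (i + 1)), (F u t - F (y i) t) := by
      rw [intervalIntegral.integral_sub (hint i hi) intervalIntegrable_const,
        intervalIntegral.integral_const, hysucc]
      simp
    rw [h1]
    have h2 := intervalIntegral.norm_integral_le_of_norm_le_const
      (f := fun u => F u t - F (y i) t) (a := y i) (b := y (i + 1)) (C := C * δ * (1 + |t|))
      (by
        intro u hu
        rw [Set.uIoc_of_le (by rw [hysucc]; linarith)] at hu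
        have huI : u ∈ Set.Icc a b := ⟨(hymem i hi.le).1.trans hu.1.le,
          hu.2.trans (hymem (i + 1) hi).2⟩
        have := hLip u huI (y i) (hymem i hi.le) t
        rw [Real.norm_eq_abs]
        refine this.trans ?_
        have h3 : |u - y i| ≤ δ := by
          rw [abs_of_nonneg (by linarith [hu.1])]
          have := hu.2
          rw [hysucc] at this
          linarith
        gcongr)
    rw [Real.norm_eq_abs, hysucc, add_sub_cancel_left, abs_of_nonneg hδ0] at h2
    rw [hysucc]
    exact h2
  have h4 : (∫ u in a..b, F u t) - (∑ i ∈ Finset.range N, δ • F (y i)) t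
      = ∑ i ∈ Finset.range N, ((∫ u in (y i)..(y (i + 1)), F u t) - δ * F (y i) t) := by
    rw [Finset.sum_sub_distrib, hsum, Finset.sum_apply]
    rfl
  rw [h4]
  calc _ ≤ ∑ i ∈ Finset.range N, C * δ * (1 + |t|) * δ :=
        (Finset.abs_sum_le_sum_abs _ _).trans (Finset.sum_le_sum hpiece)
    _ = (C * (b - a) * δ) * (1 + |t|) := by
        rw [Finset.sum_const, Finset.card_range, nsmul_eq_mul, ← hNδ]; ring
    _ ≤ ε * (1 + |t|) := by
        gcongr
        rw [hδ, ← mul_div_assoc, div_le_iff₀ hN0]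
        rw [div_lt_iff₀ hε] at hN
        linarith

/-! ### A nonzero integrable average of a Lipschitz function -/

/-- The second difference with step `h` of a bounded continuous function has a bounded second
antiderivative, the second difference of a second antiderivative of the function. -/
lemma exists_bounded_antideriv_second_difference {g : ℝ → ℝ} (hg : Continuous g) {M : ℝ}
    (hM : ∀ x, |g x| ≤ M) (h : ℝ) :
    ∃ S S' : ℝ → ℝ, ∃ C, (∀ x, HasDerivAt S (S' x) x) ∧
      (∀ x, HasDerivAt S' (g (x + h + h) - 2 * g (x + h) + g x) x) ∧ ∀ x, |S x| ≤ C := by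
  set P : ℝ → ℝ := fun x => ∫ u in (0 : ℝ)..x, g u with hP
  have hPd : ∀ x, HasDerivAt P (g x) x := fun x =>
    intervalIntegral.integral_hasDerivAt_right (hg.intervalIntegrable _ _)
      hg.aestronglyMeasurable.stronglyMeasurableAtFilter hg.continuousAt
  have hPc : Continuous P := continuous_iff_continuousAt.2 fun x => (hPd x).continuousAt
  set R : ℝ → ℝ := fun x => ∫ u in (0 : ℝ)..x, P u with hR
  have hRd : ∀ x, HasDerivAt R (P x) x := fun x =>
    intervalIntegral.integral_hasDerivAt_right (hPc.intervalIntegrable _ _)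
      hPc.aestronglyMeasurable.stronglyMeasurableAtFilter hPc.continuousAt
  have shift : ∀ {f f' : ℝ → ℝ}, (∀ x, HasDerivAt f (f' x) x) → ∀ c x,
      HasDerivAt (fun x => f (x + c)) (f' (x + c)) x := fun hf c x =>
    HasDerivAt.comp_add_const x c (hf (x + c))
  have mvt : ∀ {f f' : ℝ → ℝ} {C : ℝ}, (∀ x, HasDerivAt f (f' x) x) → (∀ x, |f' x| ≤ C) →
      ∀ x, |f (x + h) - f x| ≤ C * |h| := by
    intro f f' C hf hC x
    have := Convex.norm_image_sub_le_of_norm_hasDerivWithin_le (s := Set.univ) (x := x)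
      (y := x + h) (fun z _ => (hf z).hasDerivWithinAt) (fun z _ => hC z) convex_univ trivial
      trivial
    simpa using this
  have h1 : ∀ x, |P (x + h) - P x| ≤ M * |h| := mvt hPd hM
  have hRd1 : ∀ x, HasDerivAt (fun x => R (x + h) - R x) (P (x + h) - P x) x :=
    fun x => (shift hRd h x).sub (hRd x)
  have h2 := mvt hRd1 h1
  refine ⟨fun x => R (x + h + h) - R (x + h) - (R (x + h) - R x),
    fun x => P (x + h + h) - P (x + h) - (P (x + h) - P x), M * |h| * |h|, fun x => ?_,
    fun x => ?_, h2⟩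
  · exact (shift hRd1 h x).sub (hRd1 x)
  · have h3 : ∀ x, HasDerivAt (fun x => P (x + h) - P x) (g (x + h) - g x) x :=
      fun x => (shift hPd h x).sub (hPd x)
    exact ((shift h3 h x).sub (h3 x)).congr_deriv (by ring)

/-- Averaging a function with a bounded second antiderivative over dilations gives quadratic decay,
by integrating by parts twice in the dilation parameter. -/
lemma exists_sq_mul_abs_dilation_average_le {D S S' c : ℝ → ℝ} {C R : ℝ}
    (hD : Continuous D) (hS : ∀ x, HasDerivAt S (S' x) x) (hS' : ∀ x, HasDerivAt S' (D x) x)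
    (hC : ∀ x, |S x| ≤ C) (hc : ContDiff ℝ 2 c)
    (h0 : ∀ x, |x| = R → c x = 0 ∧ deriv c x = 0) (hR : 0 ≤ R) :
    ∃ C', ∀ t : ℝ, t ^ 2 * |∫ a in (-R)..R, c a * D (a * t)| ≤ C' := by
  have hc1 : ContDiff ℝ 1 (deriv c) :=
    ((contDiff_succ_iff_deriv (n := 1)).1 (by rw [one_add_one_eq_two]; exact hc)).2.2
  have hd0 : ∀ x, HasDerivAt c (deriv c x) x := fun x =>
    ((hc.differentiable (by norm_num)) x).hasDerivAt
  have hd1 : ∀ x, HasDerivAt (deriv c) (deriv (deriv c) x) x := fun x =>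
    ((hc1.differentiable (by norm_num)) x).hasDerivAt
  have hc1c : Continuous (deriv c) := hc1.continuous
  have hc2c : Continuous (deriv (deriv c)) := hc1.continuous_deriv (by norm_num)
  have hSc : Continuous S := continuous_iff_continuousAt.2 fun x => (hS x).continuousAt
  have hSc' : Continuous S' := continuous_iff_continuousAt.2 fun x => (hS' x).continuousAt
  obtain ⟨B, hB⟩ := (isCompact_Icc (a := -R) (b := R)).exists_bound_of_continuousOn
    hc2c.continuousOn
  have hRR := h0 R (abs_of_nonneg hR)
  have hRn := h0 (-R) (by rw [abs_neg, abs_of_nonneg hR])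
  refine ⟨B * C * |R - -R|, fun t => ?_⟩
  have hlin : ∀ a, HasDerivAt (fun a => a * t) t a := fun a => by
    simpa using (hasDerivAt_id a).mul_const t
  have i1 := intervalIntegral.integral_mul_deriv_eq_deriv_mul (a := -R) (b := R) (u := c)
    (v := fun a => S' (a * t)) (u' := deriv c) (v' := fun a => D (a * t) * t)
    (fun a _ => hd0 a) (fun a _ => (hS' _).comp a (hlin a)) (hc1c.intervalIntegrable _ _)
    ((by fun_prop : Continuous fun a => D (a * t) * t).intervalIntegrable _ _)
  have i2 := intervalIntegral.integral_mul_deriv_eq_deriv_mul (a := -R) (b := R) (u := deriv c)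
    (v := fun a => S (a * t)) (u' := deriv (deriv c)) (v' := fun a => S' (a * t) * t)
    (fun a _ => hd1 a) (fun a _ => (hS _).comp a (hlin a)) (hc2c.intervalIntegrable _ _)
    ((by fun_prop : Continuous fun a => S' (a * t) * t).intervalIntegrable _ _)
  simp only [hRR.1, hRR.2, hRn.1, hRn.2, zero_mul, sub_zero, zero_sub, ← mul_assoc,
    intervalIntegral.integral_mul_const] at i1 i2
  have h3 : t ^ 2 * (∫ a in (-R)..R, c a * D (a * t))
      = ∫ a in (-R)..R, deriv (deriv c) a * S (a * t) := by
    have : t ^ 2 * (∫ a in (-R)..R, c a * D (a * t))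
      = ((∫ a in (-R)..R, c a * D (a * t)) * t) * t := by ring
    rw [this, i1, neg_mul, i2, neg_neg]
  rw [← abs_of_nonneg (sq_nonneg t), ← abs_mul, h3, ← Real.norm_eq_abs]
  apply intervalIntegral.norm_integral_le_of_norm_le_const
  intro a ha
  rw [Set.uIoc_of_le (by linarith)] at ha
  rw [norm_mul]
  exact mul_le_mul (hB a ⟨ha.1.le, ha.2⟩) (hC _) (norm_nonneg _)
    ((norm_nonneg _).trans (hB a ⟨ha.1.le, ha.2⟩))

/-- A Lipschitz function whose third differences all vanish is affine: its first differences are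
bounded and have vanishing second differences, hence are constant. -/
lemma exists_affine_of_third_difference_eq_zero {φ : ℝ → ℝ} {K : ℝ≥0} (hφ : LipschitzWith K φ)
    (h3 : ∀ h x, (φ (x + h + h + h) - φ (x + h + h)) - 2 * (φ (x + h + h) - φ (x + h))
      + (φ (x + h) - φ x) = 0) :
    ∃ c d, ∀ t, φ t = c * t + d := by
  have hbd : ∀ h x, |φ (x + h) - φ x| ≤ K * |h| := fun h x => by
    simpa [Real.dist_eq] using hφ.dist_le_mul (x + h) x
  have h2 : ∀ h x, φ (x + h + h) - φ (x + h) = φ (x + h) - φ x := by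
    intro h x
    set g : ℝ → ℝ := fun x => φ (x + h) - φ x with hg
    set d := g (x + h) - g x with hd
    have harith : ∀ n : ℕ, g (x + n * h) = g x + n * d ∧ g (x + n * h + h) = g x + (n + 1) * d := by
      intro n
      induction n with
      | zero => simp [hd]
      | succ n ih =>
        have e1 : x + ((n + 1 : ℕ) : ℝ) * h = x + n * h + h := by push_cast; ring
        have e2 := h3 h (x + n * h)
        obtain ⟨ih1, ih2⟩ := ih
        rw [e1]
        refine ⟨by rw [ih2]; push_cast; ring, ?_⟩
        push_cast
        simp only [hg] at ih1 ih2 e2 ⊢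
        linarith
    by_contra hne
    have hd0 : 0 < |d| := by
      rw [abs_pos]
      intro h0
      apply hne
      simp only [hd, hg] at h0
      linarith
    obtain ⟨n, hn⟩ := exists_nat_gt (2 * (K * |h|) / |d|)
    rw [div_lt_iff₀ hd0] at hn
    have e3 : n * d = g (x + n * h) - g x := by rw [(harith n).1]; ring
    have e4 : n * |d| ≤ 2 * (K * |h|) := by
      rw [← Nat.abs_cast n, ← abs_mul, e3]
      exact (abs_sub _ _).trans (by linarith [hbd h x, hbd h (x + n * h)])
    linarith
  have hdouble : ∀ u, φ (2 * u) = 2 * φ u - φ 0 := by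
    intro u
    have := h2 u 0
    rw [zero_add, ← two_mul] at this
    linarith
  have hadd : ∀ u v, φ (u + v) - φ 0 = (φ u - φ 0) + (φ v - φ 0) := by
    intro u v
    have e1 := h2 ((v - u) / 2) u
    have e2 := hdouble ((u + v) / 2)
    rw [show u + (v - u) / 2 + (v - u) / 2 = v by ring,
      show u + (v - u) / 2 = (u + v) / 2 by ring] at e1
    rw [show 2 * ((u + v) / 2) = u + v by ring] at e2
    linarith
  let f : ℝ →+ ℝ := ⟨⟨fun t => φ t - φ 0, by simp⟩, hadd⟩
  let l := f.toRealLinearMap (hφ.continuous.sub continuous_const)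
  refine ⟨φ 1 - φ 0, φ 0, fun t => ?_⟩
  have : l (t • 1) = t • l 1 := l.map_smul t 1
  have h4 : φ (t • 1) - φ 0 = t • (φ 1 - φ 0) := this
  rw [smul_eq_mul, smul_eq_mul, mul_one] at h4
  linarith

/-- If `φ` is Lipschitz and not affine, then the weighted closure of the span of its dilates and
translates contains a nonzero integrable bounded Lipschitz function: an average over dilations of a
third difference of `φ`. -/
lemma exists_integrable_mem_weightedClosure {φ : ℝ → ℝ} {K : ℝ≥0} (hφ : LipschitzWith K φ)
    (hna : ¬ ∃ c d, ∀ t, φ t = c * t + d) :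
    ∃ G ∈ weightedClosure (dilationSpan φ), (∃ C : ℝ≥0, LipschitzWith C G) ∧
      (∃ Γ, ∀ t, |G t| ≤ Γ) ∧ Integrable G ∧ ∃ t, G t ≠ 0 := by
  have hex : ∃ h x, (φ (x + h + h + h) - φ (x + h + h)) - 2 * (φ (x + h + h) - φ (x + h))
      + (φ (x + h) - φ x) ≠ 0 := by
    by_contra hcon
    push Not at hcon
    exact hna (exists_affine_of_third_difference_eq_zero hφ hcon)
  obtain ⟨h, x₀, hx₀⟩ := hex
  have hφc := hφ.continuous
  set g : ℝ → ℝ := fun x => φ (x + h) - φ x with hg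
  have hgc : Continuous g := by fun_prop
  set M : ℝ := K * |h| with hM
  have hgM : ∀ x, |g x| ≤ M := fun x => by
    simpa [Real.dist_eq] using hφ.dist_le_mul (x + h) x
  have hM0 : 0 ≤ M := by positivity
  set D : ℝ → ℝ := fun x => g (x + h + h) - 2 * g (x + h) + g x with hD
  have hDc : Continuous D := by fun_prop
  have hDx₀ : D x₀ ≠ 0 := hx₀
  have hDbd : ∀ x, |D x| ≤ 4 * M := fun x => by
    have h1 := abs_le.1 (hgM (x + h + h))
    have h2 := abs_le.1 (hgM (x + h))
    have h3 := abs_le.1 (hgM x)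
    exact abs_le.2 ⟨by simp only [hD]; linarith, by simp only [hD]; linarith⟩
  have hDLip : ∀ x y, |D x - D y| ≤ 8 * K * |x - y| := fun x y => by
    have hk : ∀ u, |φ (x + u) - φ (y + u)| ≤ K * |x - y| := fun u => by
      simpa [Real.dist_eq] using hφ.dist_le_mul (x + u) (y + u)
    have e0 := abs_le.1 (hk 0)
    have e1 := abs_le.1 (hk h)
    have e2 := abs_le.1 (hk (h + h))
    have e3 := abs_le.1 (hk (h + h + h))
    simp only [add_zero, ← add_assoc] at e0 e1 e2 e3
    exact abs_le.2 ⟨by simp only [hD, hg]; linarith, by simp only [hD, hg]; linarith⟩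
  obtain ⟨S, S', C, hS, hS', hSC⟩ := exists_bounded_antideriv_second_difference hgc hgM h
  -- Some smooth compactly supported weight gives an average that does not vanish at `t = 1`.
  obtain ⟨c, hcs, hcc, hc0⟩ : ∃ c : ℝ → ℝ, ContDiff ℝ ((⊤ : ℕ∞) : WithTop ℕ∞) c ∧
      HasCompactSupport c ∧ ∫ a, c a * D a ≠ 0 := by
    by_contra hcon
    push Not at hcon
    have hae := ae_eq_zero_of_integral_contDiff_smul_eq_zero (μ := volume)
      hDc.locallyIntegrable hcon
    have : D = fun _ => 0 := Continuous.ae_eq_iff_eq volume hDc continuous_const |>.1 hae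
    exact hDx₀ (by rw [this])
  obtain ⟨R, hR0, hR⟩ : ∃ R : ℝ, 0 < R ∧ tsupport c ⊆ Metric.ball 0 R := by
    obtain ⟨R, hR⟩ := hcc.isBounded.subset_ball 0
    exact ⟨max R 1, by positivity, hR.trans (Metric.ball_subset_ball (le_max_left _ _))⟩
  have hout : ∀ x, R ≤ |x| → c x = 0 ∧ deriv c x = 0 := fun x hx => by
    have hx' : x ∉ tsupport c := fun hmem => by
      have := hR hmem
      rw [mem_ball_zero_iff, Real.norm_eq_abs] at this
      linarith
    exact ⟨image_eq_zero_of_notMem_tsupport hx', image_eq_zero_of_notMem_tsupport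
      fun hmem => hx' (tsupport_deriv_subset hmem)⟩
  have hccont : Continuous c := hcs.continuous
  obtain ⟨B, hB⟩ := hcc.exists_bound_of_continuous hccont
  have hB0 : 0 ≤ B := (norm_nonneg _).trans (hB 0)
  obtain ⟨Lc, hLc⟩ := ContDiff.lipschitzWith_of_hasCompactSupport hcc hcs (by simp)
  set G : ℝ → ℝ := fun t => ∫ a in (-R)..R, c a * D (a * t) with hG
  have hGLip : ∀ t t', |G t - G t'| ≤ B * (8 * K) * R * (2 * R) * |t - t'| := fun t t' => by
    have e1 : G t - G t' = ∫ a in (-R)..R, (c a * D (a * t) - c a * D (a * t')) := by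
      rw [intervalIntegral.integral_sub]
      · exact (by fun_prop : Continuous fun a => c a * D (a * t)).intervalIntegrable _ _
      · exact (by fun_prop : Continuous fun a => c a * D (a * t')).intervalIntegrable _ _
    rw [e1]
    have e2 := intervalIntegral.norm_integral_le_of_norm_le_const
      (f := fun a => c a * D (a * t) - c a * D (a * t')) (a := -R) (b := R)
      (C := B * (8 * K * (R * |t - t'|))) (by
        intro a ha
        rw [Set.uIoc_of_le (by linarith)] at ha
        rw [← mul_sub, norm_mul]
        have haR : |a| ≤ R := abs_le.2 ⟨ha.1.le, ha.2⟩
        refine mul_le_mul (hB a) ((hDLip _ _).trans ?_) (norm_nonneg _) hB0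
        rw [show a * t - a * t' = a * (t - t') by ring, abs_mul]
        gcongr)
    rw [Real.norm_eq_abs] at e2
    refine e2.trans (le_of_eq ?_)
    rw [abs_of_nonneg (show 0 ≤ R - -R by linarith)]
    ring
  have hGL : LipschitzWith (Real.toNNReal (B * (8 * K) * R * (2 * R))) G :=
    LipschitzWith.of_dist_le_mul fun t t' => by
      rw [Real.dist_eq, Real.dist_eq, Real.coe_toNNReal _ (by positivity)]
      exact hGLip t t'
  have hDmem : D ∈ weightedClosure (dilationSpan φ) := by
    have hs : ∀ u, (fun x => φ (x + u)) ∈ dilationSpan φ := fun u =>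
      Submodule.subset_span ⟨(1, u), by simp⟩
    have : D = (fun x => φ (x + (h + h + h))) - (3 : ℝ) • (fun x => φ (x + (h + h)))
        + (3 : ℝ) • (fun x => φ (x + h)) - (fun x => φ (x + 0)) := by
      funext x
      simp only [hD, hg, Pi.add_apply, Pi.sub_apply, Pi.smul_apply, smul_eq_mul, add_zero,
        ← add_assoc]
      ring
    rw [this]
    apply le_weightedClosure
    exact sub_mem (add_mem (sub_mem (hs _) (Submodule.smul_mem _ _ (hs _)))
      (Submodule.smul_mem _ _ (hs _))) (hs _)
  have hGb : ∀ t, |G t| ≤ B * (4 * M) * (2 * R) := fun t => by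
    have := intervalIntegral.norm_integral_le_of_norm_le_const
      (f := fun a => c a * D (a * t)) (a := -R) (b := R) (C := B * (4 * M))
      (fun a _ => by rw [norm_mul]; exact mul_le_mul (hB a) (hDbd _) (norm_nonneg _) hB0)
    rw [Real.norm_eq_abs] at this
    refine this.trans (le_of_eq ?_)
    rw [abs_of_nonneg (by linarith)]
    ring
  refine ⟨G, ?_, ⟨_, hGL⟩, ⟨_, hGb⟩, ?_, 1, ?_⟩
  · refine integral_mem_weightedClosure (F := fun a t => c a * D (a * t))
      (C := Lc * (4 * M) + B * (8 * K)) (by linarith) (by positivity)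
      (fun a => Submodule.smul_mem _ (c a)
        (by simpa using comp_affine_mem_weightedClosure hDmem a 0))
      fun a _ a' _ t => ?_
    have e1 : |c a - c a'| ≤ Lc * |a - a'| := by
      simpa [Real.dist_eq] using hLc.dist_le_mul a a'
    have e2 : |D (a * t) - D (a' * t)| ≤ 8 * K * (|a - a'| * |t|) := by
      refine (hDLip _ _).trans (le_of_eq ?_)
      rw [show a * t - a' * t = (a - a') * t by ring, abs_mul]
    calc |c a * D (a * t) - c a' * D (a' * t)|
        = |(c a - c a') * D (a * t) + c a' * (D (a * t) - D (a' * t))| := by ring_nf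
      _ ≤ |c a - c a'| * |D (a * t)| + |c a'| * |D (a * t) - D (a' * t)| := by
          rw [← abs_mul, ← abs_mul]; exact abs_add_le _ _
      _ ≤ Lc * |a - a'| * (4 * M) + B * (8 * K * (|a - a'| * |t|)) := by
          have := hB a'
          rw [Real.norm_eq_abs] at this
          gcongr
          exact hDbd _
      _ ≤ (Lc * (4 * M) + B * (8 * K)) * |a - a'| * (1 + |t|) := by
          have : 0 ≤ Lc * (4 * M) * |a - a'| * |t| := by positivity
          have : 0 ≤ B * (8 * K) * |a - a'| := by positivity
          nlinarith
  · obtain ⟨C', hC'⟩ := exists_sq_mul_abs_dilation_average_le hDc hS hS' hSC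
      (contDiff_infty.1 hcs 2) (fun x hx => hout x hx.ge) hR0.le
    refine Integrable.mono' (integrable_inv_one_add_sq.const_mul (B * (4 * M) * (2 * R) + C'))
      hGL.continuous.aestronglyMeasurable (Eventually.of_forall fun t => ?_)
    rw [Real.norm_eq_abs, ← div_eq_mul_inv, le_div_iff₀ (by positivity)]
    nlinarith [hC' t, hGb t]
  · have : G 1 = ∫ a, c a * D a := by
      simp only [hG, mul_one]
      rw [intervalIntegral.integral_of_le (by linarith),
        setIntegral_eq_integral_of_forall_compl_eq_zero]
      intro a ha
      have : R ≤ |a| := by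
        by_contra hlt
        rw [not_le, abs_lt] at hlt
        exact ha ⟨hlt.1, hlt.2.le⟩
      rw [(hout a this).1, zero_mul]
    rw [this]
    exact hc0

/-! ### Cosines in the weighted closure -/

/-- A nonzero continuous integrable function has a nonvanishing Fourier coefficient at some nonzero
frequency, by Fourier inversion and continuity of the Fourier transform. -/
lemma exists_fourier_ne_zero {G : ℝ → ℝ} (hc : Continuous G) (hi : Integrable G)
    (h0 : ∃ t, G t ≠ 0) :
    ∃ ω : ℝ, ω ≠ 0 ∧ ∫ u, Complex.exp ((-(ω * u) : ℝ) * Complex.I) * (G u : ℂ) ≠ 0 := by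
  by_contra hcon
  push Not at hcon
  set f : ℝ → ℂ := fun u => (G u : ℂ) with hf
  have hfi : Integrable f := hi.ofReal
  have hfc : Continuous f := Complex.continuous_ofReal.comp hc
  have hF : ∀ ξ, ξ ≠ 0 → FourierTransform.fourier f ξ = 0 := by
    intro ξ hξ
    have := hcon (2 * Real.pi * ξ) (by positivity)
    rw [Real.fourier_eq', ← this]
    congr 1
    funext u
    simp only [hf, smul_eq_mul, RCLike.inner_apply, conj_trivial]
    congr 3
    push_cast
    ring
  have hFc : Continuous (FourierTransform.fourier f) :=
    VectorFourier.fourierIntegral_continuous Real.continuous_fourierChar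
      (by exact continuous_inner) hfi
  have hF0 : FourierTransform.fourier f = 0 := by
    refine Continuous.ext_on (dense_compl_singleton (0 : ℝ)) hFc continuous_const fun ξ hξ => ?_
    exact hF ξ hξ
  have hinv := hfc.fourierInv_fourier_eq hfi (by rw [hF0]; exact integrable_zero _ _ _)
  obtain ⟨t, ht⟩ := h0
  apply ht
  have h1 : f t = 0 := by
    rw [← hinv, hF0]
    simp [Real.fourierInv_eq']
  exact Complex.ofReal_eq_zero.1 h1

/-- The error in truncating the integral of `b ↦ G (y + b) w (b)` to `[-B, B]` is controlled by the
mass of `|G|` outside the translated interval `[y - B, y + B]`. -/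
lemma abs_integral_sub_intervalIntegral_le {G w : ℝ → ℝ} (hG : Integrable G)
    (hw : Continuous w) {W : ℝ} (hW : ∀ b, |w b| ≤ W) {B : ℝ} (hB : 0 ≤ B) (y : ℝ) :
    |(∫ b, G (y + b) * w b) - ∫ b in (-B)..B, G (y + b) * w b|
      ≤ W * ((∫ u, |G u|) - ∫ u in (y - B)..(y + B), |G u|) := by
  have hGy : Integrable fun b => G (y + b) := hG.comp_add_left y
  have hint : Integrable fun b => G (y + b) * w b :=
    hGy.mul_bdd (c := W) hw.aestronglyMeasurable (Eventually.of_forall hW)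
  have hsplit : ∀ {f : ℝ → ℝ}, Integrable f →
      (∫ b, f b) - ∫ b in (-B)..B, f b = ∫ b in (Set.Ioc (-B) B)ᶜ, f b := fun {f} hf => by
    rw [intervalIntegral.integral_of_le (by linarith), ← integral_add_compl
      (measurableSet_Ioc (a := -B) (b := B)) hf]
    ring
  have e2 : (∫ u, |G u|) - (∫ u in (y - B)..(y + B), |G u|)
      = ∫ b in (Set.Ioc (-B) B)ᶜ, |G (y + b)| := by
    rw [← hsplit hGy.abs, integral_add_left_eq_self (fun u => |G u|) y,
      intervalIntegral.integral_comp_add_left (fun u => |G u|) y, ← sub_eq_add_neg]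
  rw [hsplit hint, e2, ← integral_const_mul, ← Real.norm_eq_abs]
  refine norm_integral_le_of_norm_le (hGy.abs.const_mul W).integrableOn
    (Eventually.of_forall fun b => ?_)
  rw [norm_mul, Real.norm_eq_abs, Real.norm_eq_abs, mul_comm]
  exact mul_le_mul_of_nonneg_right (hW b) (abs_nonneg _)

/-- Modulating the translates of an integrable member of the weighted closure by a bounded
Lipschitz function stays in the weighted closure. The integral over the line does not converge in
the weighted norm as a Bochner integral, but its truncations to `[-B, B]` do converge: the error is
small where `|α t| ≤ B / 2`, and bounded elsewhere, where the weight is large. -/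
lemma integral_mul_mem_weightedClosure {φ G w : ℝ → ℝ} {C L : ℝ≥0} {W : ℝ}
    (hGV : G ∈ weightedClosure (dilationSpan φ)) (hGL : LipschitzWith C G) (hG : Integrable G)
    {Γ : ℝ} (hΓ : ∀ t, |G t| ≤ Γ) (hwL : LipschitzWith L w) (hW : ∀ b, |w b| ≤ W) (α : ℝ) :
    (fun t => ∫ b, G (α * t + b) * w b) ∈ weightedClosure (dilationSpan φ) := by
  have hW0 : 0 ≤ W := (abs_nonneg _).trans (hW 0)
  have hΓ0 : 0 ≤ Γ := (abs_nonneg _).trans (hΓ 0)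
  have htrunc : ∀ B : ℝ, 0 ≤ B →
      (fun t => ∫ b in (-B)..B, G (α * t + b) * w b) ∈ weightedClosure (dilationSpan φ) := by
    intro B hB
    refine integral_mem_weightedClosure (F := fun b t => G (α * t + b) * w b)
      (C := C * W + Γ * L) (by linarith) (by positivity) (fun b => ?_) fun b _ b' _ t => ?_
    · have := Submodule.smul_mem _ (w b) (comp_affine_mem_weightedClosure hGV α b)
      convert this using 1
      funext t
      simp [mul_comm]
    · have e1 : |G (α * t + b) - G (α * t + b')| ≤ C * |b - b'| := by
        simpa [Real.dist_eq] using hGL.dist_le_mul (α * t + b) (α * t + b')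
      have e2 : |w b - w b'| ≤ L * |b - b'| := by
        simpa [Real.dist_eq] using hwL.dist_le_mul b b'
      calc |G (α * t + b) * w b - G (α * t + b') * w b'|
          = |(G (α * t + b) - G (α * t + b')) * w b + G (α * t + b') * (w b - w b')| := by
            ring_nf
        _ ≤ |G (α * t + b) - G (α * t + b')| * |w b| + |G (α * t + b')| * |w b - w b'| := by
            rw [← abs_mul, ← abs_mul]; exact abs_add_le _ _
        _ ≤ C * |b - b'| * W + Γ * (L * |b - b'|) := by
            gcongr
            · exact hW b
            · exact hΓ _
        _ = (C * W + Γ * L) * |b - b'| * 1 := by ring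
        _ ≤ (C * W + Γ * L) * |b - b'| * (1 + |t|) := by
            gcongr
            linarith [abs_nonneg t]
  apply weightedClosure_idem
  intro ε hε
  set I : ℝ := ∫ u, |G u| with hI
  have hI0 : 0 ≤ I := integral_nonneg fun _ => abs_nonneg _
  have hlim : Tendsto (fun r : ℝ => ∫ u in (-r)..r, |G u|) atTop (𝓝 I) :=
    intervalIntegral_tendsto_integral hG.abs tendsto_neg_atTop_atBot tendsto_id
  have hev : ∀ᶠ r : ℝ in atTop, I - ε / (W + 1) < ∫ u in (-r)..r, |G u| :=
    hlim.eventually (lt_mem_nhds (by linarith [div_pos hε (show 0 < W + 1 by linarith)]))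
  obtain ⟨r, hr, hr'⟩ := (hev.and (eventually_ge_atTop (|α| * (W * I / ε)))).exists
  have hr0 : 0 ≤ r := le_trans (by positivity) hr'
  refine ⟨_, htrunc (2 * r) (by linarith), fun t => ?_⟩
  have hmain := abs_integral_sub_intervalIntegral_le hG hwL.continuous hW
    (show 0 ≤ 2 * r by linarith) (α * t)
  refine hmain.trans ?_
  have hii : ∀ a b, IntervalIntegrable (fun u => |G u|) volume a b := fun a b =>
    hGL.continuous.abs.intervalIntegrable a b
  by_cases ht : |α * t| ≤ r
  · have ht' := abs_le.1 ht
    have hmono : ∫ u in (-r)..r, |G u| ≤ ∫ u in (α * t - 2 * r)..(α * t + 2 * r), |G u| :=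
      intervalIntegral.integral_mono_interval (by linarith) (by linarith) (by linarith)
        (Eventually.of_forall fun _ => abs_nonneg _) (hii _ _)
    calc W * (I - ∫ u in (α * t - 2 * r)..(α * t + 2 * r), |G u|)
        ≤ W * (ε / (W + 1)) := by gcongr; linarith
      _ ≤ (W + 1) * (ε / (W + 1)) := by
          gcongr
          linarith
      _ = ε * 1 := by field_simp
      _ ≤ ε * (1 + |t|) := by
          gcongr
          linarith [abs_nonneg t]
  · rw [not_le, abs_mul] at ht
    have hnn : 0 ≤ ∫ u in (α * t - 2 * r)..(α * t + 2 * r), |G u| :=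
      intervalIntegral.integral_nonneg (by linarith) fun _ _ => abs_nonneg _
    have hα : 0 < |α| := by
      rcases (abs_nonneg α).lt_or_eq with h | h
      · exact h
      · rw [← h, zero_mul] at ht; linarith
    have h1 : W * I / ε < |t| := lt_of_mul_lt_mul_left (hr'.trans_lt ht) hα.le
    rw [div_lt_iff₀ hε] at h1
    calc W * (I - ∫ u in (α * t - 2 * r)..(α * t + 2 * r), |G u|) ≤ W * I := by
          gcongr; linarith
      _ ≤ ε * (1 + |t|) := by linarith

/-- All cosines lie in the weighted closure of the span of the dilates and translates of a Lipschitz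
function that is not affine. -/
theorem cos_mem_weightedClosure {φ : ℝ → ℝ} {K : ℝ≥0} (hφ : LipschitzWith K φ)
    (hna : ¬ ∃ c d, ∀ t, φ t = c * t + d) (s θ : ℝ) :
    (fun t => Real.cos (s * t + θ)) ∈ weightedClosure (dilationSpan φ) := by
  obtain ⟨G, hGV, ⟨C, hGL⟩, ⟨Γ, hΓ⟩, hG, hG0⟩ := exists_integrable_mem_weightedClosure hφ hna
  obtain ⟨ω, hω, hz⟩ := exists_fourier_ne_zero hGL.continuous hG hG0
  set z : ℂ := ∫ u, Complex.exp ((-(ω * u) : ℝ) * Complex.I) * (G u : ℂ) with hzdef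
  -- Modulating the translates `G (α t + ·)` by `b ↦ Re (c e ^ (-iωb))` produces
  -- `Re (c e ^ (iωαt) z)`; this is `cos (s t + θ)` for `α = s / ω` and `c = e ^ (iθ) / z`.
  set c : ℂ := Complex.exp (θ * Complex.I) / z with hc
  set w : ℝ → ℝ := fun b => c.re * Real.cos (ω * b) + c.im * Real.sin (ω * b) with hw
  have hwre : ∀ b, w b = (c * Complex.exp ((-(ω * b) : ℝ) * Complex.I)).re := fun b => by
    rw [Complex.mul_re, Complex.exp_ofReal_mul_I_re, Complex.exp_ofReal_mul_I_im, Real.cos_neg,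
      Real.sin_neg]
    ring
  have hwL : LipschitzWith (Real.toNNReal ((|c.re| + |c.im|) * |ω|)) w :=
    LipschitzWith.of_dist_le_mul fun x y => by
      rw [Real.dist_eq, Real.dist_eq, Real.coe_toNNReal _ (by positivity)]
      have e1 : |Real.cos (ω * x) - Real.cos (ω * y)| ≤ |ω| * |x - y| := by
        rw [← abs_mul, mul_sub]
        simpa [Real.dist_eq] using Real.lipschitzWith_cos.dist_le_mul (ω * x) (ω * y)
      have e2 : |Real.sin (ω * x) - Real.sin (ω * y)| ≤ |ω| * |x - y| := by
        rw [← abs_mul, mul_sub]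
        simpa [Real.dist_eq] using Real.lipschitzWith_sin.dist_le_mul (ω * x) (ω * y)
      calc |w x - w y| = |c.re * (Real.cos (ω * x) - Real.cos (ω * y))
            + c.im * (Real.sin (ω * x) - Real.sin (ω * y))| := by simp only [hw]; ring_nf
        _ ≤ |c.re| * |Real.cos (ω * x) - Real.cos (ω * y)|
            + |c.im| * |Real.sin (ω * x) - Real.sin (ω * y)| := by
            rw [← abs_mul, ← abs_mul]; exact abs_add_le _ _
        _ ≤ |c.re| * (|ω| * |x - y|) + |c.im| * (|ω| * |x - y|) := by gcongr
        _ = (|c.re| + |c.im|) * |ω| * |x - y| := by ring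
  have hW : ∀ b, |w b| ≤ ‖c‖ := fun b => by
    rw [hwre]
    refine (Complex.abs_re_le_norm _).trans (le_of_eq ?_)
    rw [norm_mul, Complex.norm_exp_ofReal_mul_I, mul_one]
  convert integral_mul_mem_weightedClosure hGV hGL hG hΓ hwL hW (s / ω) using 1
  funext t
  have h1 : ∫ b, G (s / ω * t + b) * w b = ∫ u, G u * w (u - s / ω * t) := by
    rw [← integral_add_left_eq_self (fun u => G u * w (u - s / ω * t)) (s / ω * t)]
    simp
  have h2 : ∀ u, G u * w (u - s / ω * t) = (c * Complex.exp ((s * t : ℝ) * Complex.I)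
      * (Complex.exp ((-(ω * u) : ℝ) * Complex.I) * (G u : ℂ))).re := fun u => by
    have e1 : c * Complex.exp ((s * t : ℝ) * Complex.I)
        * (Complex.exp ((-(ω * u) : ℝ) * Complex.I) * (G u : ℂ))
        = (G u : ℂ) * (c * Complex.exp ((-(ω * (u - s / ω * t)) : ℝ) * Complex.I)) := by
      have e2 : -(ω * (u - s / ω * t)) = s * t + -(ω * u) := by field_simp; ring
      rw [e2, Complex.ofReal_add, add_mul, Complex.exp_add]
      ring
    rw [e1, Complex.re_ofReal_mul, hwre]
  have hi : Integrable fun u => Complex.exp ((-(ω * u) : ℝ) * Complex.I) * (G u : ℂ) :=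
    (hG.ofReal (𝕜 := ℂ)).bdd_mul (c := 1)
      (by fun_prop : Continuous fun u : ℝ =>
        Complex.exp ((-(ω * u) : ℝ) * Complex.I)).aestronglyMeasurable
      (Eventually.of_forall fun u => (Complex.norm_exp_ofReal_mul_I _).le)
  have h3 : ∫ u, G u * w (u - s / ω * t)
      = (c * Complex.exp ((s * t : ℝ) * Complex.I) * z).re := by
    simp_rw [h2]
    have := integral_re (hi.const_mul (c * Complex.exp ((s * t : ℝ) * Complex.I)))
    rw [integral_const_mul] at this
    exact this
  have h4 : c * Complex.exp ((s * t : ℝ) * Complex.I) * z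
      = Complex.exp ((s * t + θ : ℝ) * Complex.I) := by
    rw [Complex.ofReal_add, add_mul, Complex.exp_add, hc]
    field_simp
  rw [h1, h3, h4, Complex.exp_ofReal_mul_I_re]

/-! ### Spans of ridge functions -/

/-- The linear span of the ridge functions `x ↦ φ (a ⬝ x + b)` on `ℝ^m`. -/
def ridgeSpan (φ : ℝ → ℝ) (m : ℕ) : Submodule ℝ ((Fin m → ℝ) → ℝ) :=
  Submodule.span ℝ (Set.range fun q : (Fin m → ℝ) × ℝ => fun x => φ (q.1 ⬝ᵥ x + q.2))

lemma exists_lipschitzWith_dotProduct {m : ℕ} (a : Fin m → ℝ) :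
    ∃ C : ℝ≥0, LipschitzWith C fun x : Fin m → ℝ => a ⬝ᵥ x := by
  have h := (∑ i, a i • (ContinuousLinearMap.proj i : (Fin m → ℝ) →L[ℝ] ℝ)).lipschitz
  have heq : ⇑(∑ i, a i • (ContinuousLinearMap.proj i : (Fin m → ℝ) →L[ℝ] ℝ))
      = fun x => a ⬝ᵥ x := by
    funext x
    simp [dotProduct]
  exact ⟨_, heq ▸ h⟩

lemma exists_lipschitzWith_of_mem_ridgeSpan {φ : ℝ → ℝ} {K : ℝ≥0} (hφ : LipschitzWith K φ) {m : ℕ}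
    {f : (Fin m → ℝ) → ℝ} (hf : f ∈ ridgeSpan φ m) : ∃ C : ℝ≥0, LipschitzWith C f := by
  induction hf using Submodule.span_induction with
  | mem x h =>
    obtain ⟨⟨a, b⟩, rfl⟩ := h
    obtain ⟨C, hC⟩ := exists_lipschitzWith_dotProduct a
    exact ⟨_, hφ.comp (hC.add (LipschitzWith.const b))⟩
  | zero => exact ⟨0, LipschitzWith.const 0⟩
  | add x y _ _ hx hy =>
    obtain ⟨C, hC⟩ := hx
    obtain ⟨C', hC'⟩ := hy
    exact ⟨_, hC.add hC'⟩
  | smul c x _ hx =>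
    obtain ⟨C, hC⟩ := hx
    exact ⟨_, (lipschitzWith_smul c).comp hC⟩

lemma const_mem_ridgeSpan {φ : ℝ → ℝ} (hφ : ∃ t, φ t ≠ 0) (m : ℕ) (c : ℝ) :
    (fun _ => c) ∈ ridgeSpan φ m := by
  obtain ⟨t, ht⟩ := hφ
  have h : (fun x : Fin m → ℝ => φ ((0 : Fin m → ℝ) ⬝ᵥ x + t)) ∈ ridgeSpan φ m :=
    Submodule.subset_span ⟨(0, t), rfl⟩
  convert Submodule.smul_mem _ (c / φ t) h using 1
  funext x
  simp [ht]

lemma comp_dotProduct_mem_ridgeSpan {φ g : ℝ → ℝ} (hg : g ∈ dilationSpan φ) {m : ℕ}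
    (w : Fin m → ℝ) : (fun x => g (w ⬝ᵥ x)) ∈ ridgeSpan φ m := by
  induction hg using Submodule.span_induction with
  | mem x h =>
    obtain ⟨⟨a, b⟩, rfl⟩ := h
    exact Submodule.subset_span ⟨(a • w, b), by simp⟩
  | zero => exact (ridgeSpan φ m).zero_mem
  | add x y _ _ hx hy => exact (ridgeSpan φ m).add_mem hx hy
  | smul c x _ hx => exact (ridgeSpan φ m).smul_mem c hx

lemma apply_mem_ridgeSpan_of_mem_NN {φ : ℝ → ℝ} (hφ : ∃ t, φ t ≠ 0) {n m : ℕ}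
    {f : (Fin m → ℝ) → (Fin n → ℝ)} (hf : f ∈ NN φ n m) (i : Fin n) :
    (fun x => f x i) ∈ ridgeSpan φ m := by
  obtain ⟨r, -, W₁, θ₁, W₂, θ₂, rfl⟩ := hf
  have : (fun x => (W₂ *ᵥ (fun i => φ ((W₁ *ᵥ x + θ₁) i)) + θ₂) i)
      = (∑ j, W₂ i j • fun x => φ (W₁ j ⬝ᵥ x + θ₁ j)) + fun _ => θ₂ i := by
    funext x
    simp [Matrix.mulVec, dotProduct]
  rw [this]
  exact add_mem (Submodule.sum_mem _ fun j _ => Submodule.smul_mem _ _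
    (Submodule.subset_span ⟨(W₁ j, θ₁ j), rfl⟩)) (const_mem_ridgeSpan hφ m _)

/-- A map all of whose coordinates are linear combinations of ridge functions is a network: the
finitely many ridge functions that occur in some coordinate form a common hidden layer. -/
lemma mem_NN_of_forall_mem_ridgeSpan {φ : ℝ → ℝ} {n m : ℕ} {f : Fin n → (Fin m → ℝ) → ℝ}
    (hf : ∀ i, f i ∈ ridgeSpan φ m) : (fun x i => f i x) ∈ NN φ n m := by
  classical
  choose c hc using fun i => Finsupp.mem_span_range_iff_exists_finsupp.1 (hf i)
  -- Inserting one more index makes the width positive.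
  let s : Finset ((Fin m → ℝ) × ℝ) := insert (0, 0) (Finset.univ.biUnion fun i => (c i).support)
  let e := s.equivFin.symm
  refine ⟨s.card, Finset.card_pos.2 ⟨_, Finset.mem_insert_self _ _⟩,
    Matrix.of fun j => (e j).1.1, fun j => (e j).1.2, Matrix.of fun i j => c i (e j).1, 0, ?_⟩
  funext x i
  rw [← hc i, Finsupp.sum_of_support_subset (c i) (s := s)]
  · rw [Finset.sum_apply, ← Finset.sum_coe_sort s, ← Equiv.sum_comp e]
    simp [Matrix.mulVec, dotProduct]
  · exact (Finset.subset_biUnion_of_mem (fun i => (c i).support) (Finset.mem_univ i)).trans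
      (Finset.subset_insert _ _)
  · simp

/-! ### Integrals of Lipschitz functions over the Wasserstein space -/

lemma exists_norm_le_mul_seminorm {k : ℕ} (nrm : Seminorm ℝ (Fin k → ℝ))
    (hnrm : ∀ x, nrm x = 0 → x = 0) : ∃ C : ℝ, 0 ≤ C ∧ ∀ x, ‖x‖ ≤ C * nrm x := by
  have hcont : Continuous nrm := nrm.convexOn.locallyLipschitz.continuous
  rcases (Metric.sphere (0 : Fin k → ℝ) 1).eq_empty_or_nonempty with hS | hS
  · refine ⟨0, le_rfl, fun x => ?_⟩
    rw [zero_mul]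
    by_contra hx
    rw [not_le] at hx
    have : ‖x‖⁻¹ • x ∈ Metric.sphere (0 : Fin k → ℝ) 1 := by
      rw [mem_sphere_zero_iff_norm, norm_smul, norm_inv, norm_norm, inv_mul_cancel₀ hx.ne']
    rw [hS] at this
    exact this
  · obtain ⟨x₀, hx₀, hmin⟩ := (isCompact_sphere (0 : Fin k → ℝ) 1).exists_isMinOn hS
      hcont.continuousOn
    have hpos : 0 < nrm x₀ := by
      refine (apply_nonneg nrm x₀).lt_of_ne fun h => ?_
      have := hnrm x₀ h.symm
      rw [this, mem_sphere_zero_iff_norm, norm_zero] at hx₀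
      exact zero_ne_one hx₀
    refine ⟨(nrm x₀)⁻¹, by positivity, fun x => ?_⟩
    rcases (norm_nonneg x).eq_or_lt with hx | hx
    · rw [← hx]; positivity
    have hmem : ‖x‖⁻¹ • x ∈ Metric.sphere (0 : Fin k → ℝ) 1 := by
      rw [mem_sphere_zero_iff_norm, norm_smul, norm_inv, norm_norm, inv_mul_cancel₀ hx.ne']
    have h1 : nrm x₀ ≤ nrm (‖x‖⁻¹ • x) := hmin hmem
    rw [map_smul_eq_mul, norm_inv, norm_norm, inv_mul_eq_div, le_div_iff₀ hx] at h1
    rw [inv_mul_eq_div, le_div_iff₀ hpos]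
    linarith

namespace WassersteinSpace

variable {k : ℕ} {nrm : Seminorm ℝ (Fin k → ℝ)} {p : ℝ}

instance (μ : WassersteinSpace nrm p) : IsProbabilityMeasure μ.toMeasure := μ.isProbabilityMeasure

lemma toMeasure_injective : Function.Injective (toMeasure : WassersteinSpace nrm p → _) := by
  rintro ⟨μ, _, _⟩ ⟨ν, _, _⟩ h
  cases h
  rfl

lemma integrable_norm (hnrm : ∀ x, nrm x = 0 → x = 0) (hp : 1 ≤ p) (μ : WassersteinSpace nrm p) :
    Integrable (fun x => ‖x‖) μ.toMeasure := by
  obtain ⟨C, hC0, hC⟩ := exists_norm_le_mul_seminorm nrm hnrm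
  have hcont : Continuous nrm := nrm.convexOn.locallyLipschitz.continuous
  have h1 : Integrable (fun x => nrm x) μ.toMeasure := by
    refine ⟨hcont.aestronglyMeasurable, ?_⟩
    refine lt_of_le_of_lt (lintegral_mono fun x => ?_)
      (show ∫⁻ x, (1 + ENNReal.ofReal (nrm x) ^ p) ∂μ.toMeasure < ∞ from ?_)
    · rw [Real.enorm_of_nonneg (apply_nonneg nrm x)]
      rcases le_total (ENNReal.ofReal (nrm x)) 1 with h | h
      · exact h.trans le_self_add
      · exact (ENNReal.le_rpow_self_of_one_le h hp).trans le_add_self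
    · rw [lintegral_add_left measurable_const]
      refine ENNReal.add_lt_top.2 ⟨by simp, μ.finite_moment⟩
  exact (h1.const_mul C).mono' continuous_norm.aestronglyMeasurable
    (Eventually.of_forall fun x => by rw [norm_norm]; exact hC x)

lemma integrable_of_lipschitzWith (hnrm : ∀ x, nrm x = 0 → x = 0) (hp : 1 ≤ p)
    {f : (Fin k → ℝ) → ℝ} {C : ℝ≥0} (hf : LipschitzWith C f) (μ : WassersteinSpace nrm p) :
    Integrable f μ.toMeasure := by
  refine (((integrable_norm hnrm hp μ).const_mul (C : ℝ)).add (integrable_const |f 0|)).mono'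
    hf.continuous.aestronglyMeasurable (Eventually.of_forall fun x => ?_)
  have h := hf.dist_le_mul x 0
  rw [dist_zero_right, Real.dist_eq] at h
  rw [Real.norm_eq_abs]
  simp only [Pi.add_apply]
  linarith [abs_sub_abs_le_abs_sub (f x) (f 0)]

/-- The easy half of Kantorovich duality: integrals of Lipschitz functions depend in a Lipschitz
way on the measure. -/
lemma abs_integral_sub_integral_le (hnrm : ∀ x, nrm x = 0 → x = 0) (hp : 1 ≤ p)
    {f : (Fin k → ℝ) → ℝ} {L : ℝ≥0} (hf : LipschitzWith L f) {C : ℝ} (hC0 : 0 ≤ C)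
    (hfC : ∀ x y, |f x - f y| ≤ C * nrm (x - y)) {δ : ℝ}
    (μ ν : WassersteinSpace nrm p) (hd : dist μ ν < ENNReal.ofReal δ) :
    |∫ x, f x ∂μ.toMeasure - ∫ x, f x ∂ν.toMeasure| ≤ C * δ := by
  have hp0 : 0 < p := by linarith
  have hδ : 0 < δ := ENNReal.ofReal_pos.1 (bot_le.trans_lt hd)
  have hcont : Continuous nrm := nrm.convexOn.locallyLipschitz.continuous
  rw [dist, one_div, ENNReal.rpow_inv_lt_iff hp0] at hd
  simp only [iInf_lt_iff] at hd
  obtain ⟨π, ⟨hπ1, hπ2⟩, hπ⟩ := hd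
  have : IsProbabilityMeasure π := by
    have : IsProbabilityMeasure (π.map Prod.fst) := by rw [hπ1]; infer_instance
    exact Measure.isProbabilityMeasure_of_map Prod.fst
  have hc2 : Continuous fun z : (Fin k → ℝ) × (Fin k → ℝ) => nrm (z.1 - z.2) := by fun_prop
  have hmom : ∫⁻ z, ENNReal.ofReal (nrm (z.1 - z.2)) ∂π < ENNReal.ofReal δ := by
    have h := eLpNorm'_le_eLpNorm'_of_exponent_le one_pos hp π hc2.aestronglyMeasurable
    simp only [eLpNorm', ENNReal.rpow_one, div_one,
      Real.enorm_of_nonneg (apply_nonneg nrm _)] at h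
    refine h.trans_lt ?_
    rw [one_div, ENNReal.rpow_inv_lt_iff hp0]
    exact hπ
  have hi : Integrable (fun z : (Fin k → ℝ) × (Fin k → ℝ) => nrm (z.1 - z.2)) π := by
    refine ⟨hc2.aestronglyMeasurable, ?_⟩
    simp only [HasFiniteIntegral, Real.enorm_of_nonneg (apply_nonneg nrm _)]
    exact hmom.trans ENNReal.ofReal_lt_top
  have hmom' : ∫ z, nrm (z.1 - z.2) ∂π ≤ δ := by
    rw [integral_eq_lintegral_of_nonneg_ae (Eventually.of_forall fun z => apply_nonneg nrm _)
      hc2.aestronglyMeasurable]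
    exact ENNReal.toReal_le_of_le_ofReal hδ.le hmom.le
  have hfμ := integrable_of_lipschitzWith hnrm hp hf μ
  have hfν := integrable_of_lipschitzWith hnrm hp hf ν
  rw [← hπ1] at hfμ ⊢
  rw [← hπ2] at hfν ⊢
  rw [integral_map measurable_fst.aemeasurable hf.continuous.aestronglyMeasurable,
    integral_map measurable_snd.aemeasurable hf.continuous.aestronglyMeasurable,
    ← integral_sub (f := fun z : (Fin k → ℝ) × (Fin k → ℝ) => f z.1) (g := fun z => f z.2)
      (hfμ.comp_measurable measurable_fst) (hfν.comp_measurable measurable_snd),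
    ← Real.norm_eq_abs]
  refine (norm_integral_le_of_norm_le (hi.const_mul C) (Eventually.of_forall fun z =>
    hfC z.1 z.2)).trans ?_
  rw [integral_const_mul]
  gcongr

/-- Integration of a Lipschitz function is continuous for the topology of the Wasserstein
distance. -/
lemma continuous_integral (hnrm : ∀ x, nrm x = 0 → x = 0) (hp : 1 ≤ p)
    {f : (Fin k → ℝ) → ℝ} {L : ℝ≥0} (hf : LipschitzWith L f) :
    Continuous fun μ : WassersteinSpace nrm p => ∫ x, f x ∂μ.toMeasure := by
  obtain ⟨C, hC0, hC⟩ := exists_norm_le_mul_seminorm nrm hnrm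
  have hfC : ∀ x y, |f x - f y| ≤ (L * C) * nrm (x - y) := fun x y => by
    have h := hf.dist_le_mul x y
    rw [Real.dist_eq, dist_eq_norm] at h
    refine h.trans ?_
    rw [mul_assoc]
    gcongr
    exact hC _
  refine ⟨fun U hU μ hμ => ?_⟩
  obtain ⟨ε, hε, hball⟩ := Metric.isOpen_iff.1 hU _ hμ
  refine ⟨ENNReal.ofReal (ε / (L * C + 1)), ENNReal.ofReal_pos.2 (by positivity),
    fun ν hν => hball ?_⟩
  have h := abs_integral_sub_integral_le hnrm hp hf (show 0 ≤ L * C by positivity)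
    hfC μ ν hν
  rw [Metric.mem_ball, Real.dist_eq, abs_sub_comm]
  refine h.trans_lt ?_
  rw [← mul_div_assoc, div_lt_iff₀ (by positivity)]
  nlinarith

/-- The integrals of the ridge functions determine the measure: by the approximation of cosines
with linear weight, they determine the characteristic function. -/
theorem eq_of_forall_mem_ridgeSpan (hnrm : ∀ x, nrm x = 0 → x = 0) (hp : 1 ≤ p) {φ : ℝ → ℝ}
    {K : ℝ≥0} (hφ : LipschitzWith K φ) (hna : ¬ ∃ c d, ∀ t, φ t = c * t + d)
    {μ ν : WassersteinSpace nrm p}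
    (h : ∀ f ∈ ridgeSpan φ k, ∫ x, f x ∂μ.toMeasure = ∫ x, f x ∂ν.toMeasure) : μ = ν := by
  have hcos : ∀ (w : Fin k → ℝ) (θ : ℝ), ∫ x, Real.cos (w ⬝ᵥ x + θ) ∂μ.toMeasure
      = ∫ x, Real.cos (w ⬝ᵥ x + θ) ∂ν.toMeasure := by
    intro w θ
    obtain ⟨Cw, hCw⟩ := exists_lipschitzWith_dotProduct w
    have hwc : Continuous fun x : Fin k → ℝ => w ⬝ᵥ x := hCw.continuous
    have hi : ∀ η : WassersteinSpace nrm p,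
        Integrable (fun x => 1 + |w ⬝ᵥ x|) η.toMeasure := fun η =>
      (integrable_const _).add (integrable_of_lipschitzWith hnrm hp hCw η).abs
    set J : WassersteinSpace nrm p → ℝ := fun η => ∫ x, (1 + |w ⬝ᵥ x|) ∂η.toMeasure with hJ
    have hJ0 : ∀ η, 0 ≤ J η := fun η => integral_nonneg fun x => by positivity
    have key : ∀ ε > 0, |∫ x, Real.cos (w ⬝ᵥ x + θ) ∂μ.toMeasure
        - ∫ x, Real.cos (w ⬝ᵥ x + θ) ∂ν.toMeasure| ≤ ε * (J μ + J ν) := by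
      intro ε hε
      obtain ⟨g, hg, hgε⟩ := mem_weightedClosure.1 (cos_mem_weightedClosure hφ hna 1 θ) ε hε
      have hgr := comp_dotProduct_mem_ridgeSpan hg w
      obtain ⟨Cg, hCg⟩ := exists_lipschitzWith_of_mem_ridgeSpan hφ hgr
      have happ : ∀ η : WassersteinSpace nrm p, |∫ x, Real.cos (w ⬝ᵥ x + θ) ∂η.toMeasure
          - ∫ x, g (w ⬝ᵥ x) ∂η.toMeasure| ≤ ε * J η := fun η => by
        rw [← integral_sub, ← Real.norm_eq_abs, hJ, ← integral_const_mul]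
        · refine norm_integral_le_of_norm_le ((hi η).const_mul ε)
            (Eventually.of_forall fun x => ?_)
          simpa using hgε (w ⬝ᵥ x)
        · exact Integrable.of_bound
            (by fun_prop : Continuous fun x => Real.cos (w ⬝ᵥ x + θ)).aestronglyMeasurable 1
            (Eventually.of_forall fun x => Real.abs_cos_le_one _)
        · exact integrable_of_lipschitzWith hnrm hp hCg η
      have hμ := abs_le.1 (happ μ)
      have hν := abs_le.1 (happ ν)
      have heq := h _ hgr
      exact abs_le.2 ⟨by linarith, by linarith⟩
    have h0 : |∫ x, Real.cos (w ⬝ᵥ x + θ) ∂μ.toMeasure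
        - ∫ x, Real.cos (w ⬝ᵥ x + θ) ∂ν.toMeasure| ≤ 0 := by
      refine le_of_forall_pos_le_add fun ε hε => ?_
      have hpos : 0 < J μ + J ν + 1 := by linarith [hJ0 μ, hJ0 ν]
      refine (key (ε / (J μ + J ν + 1)) (by positivity)).trans ?_
      rw [zero_add, div_mul_eq_mul_div, div_le_iff₀ hpos]
      nlinarith
    exact sub_eq_zero.1 (abs_nonpos_iff.1 h0)
  apply toMeasure_injective
  apply Measure.ext_of_charFunDual
  ext ℓ
  set w : Fin k → ℝ := fun i => ℓ (Pi.single i 1) with hw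
  have hℓ : ∀ x, ℓ x = w ⬝ᵥ x := fun x => by
    conv_lhs => rw [← Finset.univ_sum_single x, map_sum]
    refine Finset.sum_congr rfl fun i _ => ?_
    have : Pi.single i (x i) = x i • (Pi.single i 1 : Fin k → ℝ) := by
      rw [← Pi.single_smul, smul_eq_mul, mul_one]
    rw [this, map_smul, smul_eq_mul, mul_comm]
  have hsplit : ∀ η : WassersteinSpace nrm p, charFunDual η.toMeasure ℓ
      = ((∫ x, Real.cos (w ⬝ᵥ x + 0) ∂η.toMeasure : ℝ) : ℂ)
        + ((∫ x, Real.cos (w ⬝ᵥ x + -(Real.pi / 2)) ∂η.toMeasure : ℝ) : ℂ) * Complex.I := by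
    intro η
    obtain ⟨Cw, hCw⟩ := exists_lipschitzWith_dotProduct w
    have hwc : Continuous fun x : Fin k → ℝ => w ⬝ᵥ x := hCw.continuous
    have hi : ∀ θ, Integrable (fun x => ((Real.cos (w ⬝ᵥ x + θ) : ℝ) : ℂ)) η.toMeasure := fun θ =>
      (Integrable.of_bound
        (by fun_prop : Continuous fun x => Real.cos (w ⬝ᵥ x + θ)).aestronglyMeasurable 1
        (Eventually.of_forall fun x => Real.abs_cos_le_one _)).ofReal
    rw [charFunDual_apply, ← integral_complex_ofReal, ← integral_complex_ofReal,
      ← integral_mul_const, ← integral_add (hi _) ((hi _).mul_const _)]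
    congr 1
    funext x
    rw [hℓ, Complex.exp_mul_I, add_zero, ← sub_eq_add_neg, Real.cos_sub_pi_div_two]
    simp
  rw [hsplit, hsplit, hcos, hcos]

end WassersteinSpace

/-! ### Density of the models -/

lemma integrable_of_mem_NN {k : ℕ} {nrm : Seminorm ℝ (Fin k → ℝ)}
    (hnrm : ∀ x, nrm x = 0 → x = 0) {p : ℝ} (hp : 1 ≤ p) {φ : ℝ → ℝ} {K : ℝ≥0}
    (hφ : LipschitzWith K φ) (hφ0 : ∃ t, φ t ≠ 0) {r : ℕ} {ρ : (Fin k → ℝ) → (Fin r → ℝ)}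
    (hρ : ρ ∈ NN φ r k) (μ : WassersteinSpace nrm p) : Integrable ρ μ.toMeasure :=
  Integrable.of_eval fun i => by
    obtain ⟨C, hC⟩ := exists_lipschitzWith_of_mem_ridgeSpan hφ
      (apply_mem_ridgeSpan_of_mem_NN hφ0 hρ i)
    exact WassersteinSpace.integrable_of_lipschitzWith hnrm hp hC μ

lemma continuous_of_mem_normalizedDeepSetsClass {k : ℕ} {nrm : Seminorm ℝ (Fin k → ℝ)}
    (hnrm : ∀ x, nrm x = 0 → x = 0) {p : ℝ} (hp : 1 ≤ p) {φ : ℝ → ℝ} {K : ℝ≥0}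
    (hφ : LipschitzWith K φ) (hφ0 : ∃ t, φ t ≠ 0) {F : WassersteinSpace nrm p → ℝ}
    (hF : F ∈ normalizedDeepSetsClass φ nrm p) : Continuous F := by
  obtain ⟨r, -, ρ, hρ, σ, hσ, rfl⟩ := hF
  obtain ⟨C, hC⟩ := exists_lipschitzWith_of_mem_ridgeSpan hφ
    (apply_mem_ridgeSpan_of_mem_NN hφ0 hσ 0)
  refine hC.continuous.comp (continuous_pi fun i => ?_)
  obtain ⟨C', hC'⟩ := exists_lipschitzWith_of_mem_ridgeSpan hφ
    (apply_mem_ridgeSpan_of_mem_NN hφ0 hρ i)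
  have h := WassersteinSpace.continuous_integral (nrm := nrm) hnrm hp hC'
  convert h using 1
  funext μ
  exact eval_integral
    (fun i => (integrable_of_mem_NN hnrm hp hφ hφ0 hρ μ).eval i) i

/-- Linear combinations of the functions `μ ↦ φ (∫ f dμ)`, with `f` in the ridge span, are
normalized DeepSets models: the functions `f` are the coordinates of the inner network and the outer
network applies `φ` to each coordinate. -/
lemma mem_normalizedDeepSetsClass_of_mem_span {k : ℕ} {nrm : Seminorm ℝ (Fin k → ℝ)}
    (hnrm : ∀ x, nrm x = 0 → x = 0) {p : ℝ} (hp : 1 ≤ p) {φ : ℝ → ℝ} {K : ℝ≥0}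
    (hφ : LipschitzWith K φ) {F : WassersteinSpace nrm p → ℝ}
    (hF : F ∈ Submodule.span ℝ (Set.range fun (f : ridgeSpan φ k) (μ : WassersteinSpace nrm p) =>
      φ (∫ x, f.1 x ∂μ.toMeasure))) : F ∈ normalizedDeepSetsClass φ nrm p := by
  classical
  obtain ⟨c, rfl⟩ := Finsupp.mem_span_range_iff_exists_finsupp.1 hF
  -- Inserting `0` makes the width positive.
  let s : Finset (ridgeSpan φ k) := insert 0 c.support
  let e := s.equivFin.symm
  have hs : 1 ≤ s.card := Finset.card_pos.2 ⟨_, Finset.mem_insert_self _ _⟩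
  refine ⟨s.card, hs, fun x i => (e i).1.1 x,
    mem_NN_of_forall_mem_ridgeSpan fun i => (e i).1.2,
    fun y => (Matrix.of fun (_ : Fin 1) j => c (e j).1) *ᵥ
      (fun i => φ (((1 : Matrix (Fin s.card) (Fin s.card) ℝ) *ᵥ y + 0) i)) + 0,
    ⟨s.card, hs, 1, 0, _, 0, rfl⟩, ?_⟩
  funext μ
  have hint : ∀ i, (∫ x, (fun i => (e i).1.1 x) ∂μ.toMeasure) i
      = ∫ x, (e i).1.1 x ∂μ.toMeasure := fun i =>
    eval_integral (fun i => by
      obtain ⟨C, hC⟩ := exists_lipschitzWith_of_mem_ridgeSpan hφ (e i).1.2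
      exact WassersteinSpace.integrable_of_lipschitzWith hnrm hp hC μ) i
  rw [Finsupp.sum_of_support_subset c (s := s) (Finset.subset_insert _ _) _ (by simp),
    Finset.sum_apply, ← Finset.sum_coe_sort s, ← Equiv.sum_comp e]
  simp [normalizedDeepSets, Matrix.mulVec, dotProduct, hint]

section Density

variable {k : ℕ} {nrm : Seminorm ℝ (Fin k → ℝ)} {p : ℝ}

/-- The span in `C(Q, ℝ)` of the functions `μ ↦ ψ (∫ f dμ)` with `f` in the ridge span of `φ`. -/
def integralSpan (φ ψ : ℝ → ℝ) (Q : Set (WassersteinSpace nrm p)) : Submodule ℝ C(Q, ℝ) :=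
  Submodule.span ℝ {g | ∃ f ∈ ridgeSpan φ k, ∀ μ : Q, g μ = ψ (∫ x, f x ∂μ.1.toMeasure)}

/-- The product formula for cosines makes the span of the functions `μ ↦ cos (∫ f dμ)` a
subalgebra. -/
lemma mul_mem_integralSpan_cos (hnrm : ∀ x, nrm x = 0 → x = 0) (hp : 1 ≤ p) {φ : ℝ → ℝ} {K : ℝ≥0}
    (hφ : LipschitzWith K φ) {Q : Set (WassersteinSpace nrm p)} {u v : C(Q, ℝ)}
    (hu : u ∈ integralSpan φ Real.cos Q) (hv : v ∈ integralSpan φ Real.cos Q) :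
    u * v ∈ integralSpan φ Real.cos Q := by
  have hmem : ∀ f ∈ ridgeSpan φ k, ∃ g ∈ integralSpan φ Real.cos Q,
      ∀ μ : Q, g μ = Real.cos (∫ x, f x ∂μ.1.toMeasure) := fun f hf => by
    obtain ⟨C, hC⟩ := exists_lipschitzWith_of_mem_ridgeSpan hφ hf
    refine ⟨⟨fun μ : Q => Real.cos (∫ x, f x ∂μ.1.toMeasure), Real.continuous_cos.comp
      ((WassersteinSpace.continuous_integral hnrm hp hC).comp continuous_subtype_val)⟩,
      Submodule.subset_span ⟨f, hf, fun _ => rfl⟩, fun _ => rfl⟩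
  have hint : ∀ f ∈ ridgeSpan φ k, ∀ μ : WassersteinSpace nrm p, Integrable f μ.toMeasure :=
    fun f hf μ => by
      obtain ⟨C, hC⟩ := exists_lipschitzWith_of_mem_ridgeSpan hφ hf
      exact WassersteinSpace.integrable_of_lipschitzWith hnrm hp hC μ
  induction hu, hv using Submodule.span_induction₂ with
  | mem_mem u v hu hv =>
    obtain ⟨f, hf, hu⟩ := hu
    obtain ⟨f', hf', hv⟩ := hv
    obtain ⟨g, hg, hg'⟩ := hmem _ (add_mem hf hf')
    obtain ⟨g₁, hg₁, hg₁'⟩ := hmem _ (sub_mem hf hf')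
    have : u * v = (2⁻¹ : ℝ) • (g + g₁) := by
      ext μ
      simp only [ContinuousMap.mul_apply, ContinuousMap.smul_apply, ContinuousMap.add_apply,
        smul_eq_mul, hu, hv, hg', hg₁', Pi.add_apply, Pi.sub_apply]
      rw [integral_add (hint _ hf _) (hint _ hf' _), integral_sub (hint _ hf _) (hint _ hf' _),
        Real.cos_add, Real.cos_sub]
      ring
    rw [this]
    exact Submodule.smul_mem _ _ (add_mem hg hg₁)
  | zero_left v hv => rw [zero_mul]; exact Submodule.zero_mem _
  | zero_right u hu => rw [mul_zero]; exact Submodule.zero_mem _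
  | add_left u u' v _ _ _ h h' => rw [add_mul]; exact add_mem h h'
  | add_right u v v' _ _ _ h h' => rw [mul_add]; exact add_mem h h'
  | smul_left c u v _ _ h => rw [smul_mul_assoc]; exact Submodule.smul_mem _ _ h
  | smul_right c u v _ _ h => rw [mul_smul_comm]; exact Submodule.smul_mem _ _ h

/-- The span of the functions `μ ↦ cos (∫ f dμ)` is dense, by the Stone–Weierstrass theorem. -/
lemma topologicalClosure_integralSpan_cos (hnrm : ∀ x, nrm x = 0 → x = 0) (hp : 1 ≤ p)
    {φ : ℝ → ℝ} {K : ℝ≥0} (hφ : LipschitzWith K φ) (hna : ¬ ∃ c d, ∀ t, φ t = c * t + d)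
    (hφ0 : ∃ t, φ t ≠ 0) (Q : Set (WassersteinSpace nrm p)) [CompactSpace Q] :
    (integralSpan φ Real.cos Q).topologicalClosure = ⊤ := by
  have hone : (1 : C(Q, ℝ)) ∈ integralSpan φ Real.cos Q :=
    Submodule.subset_span ⟨0, Submodule.zero_mem _, fun μ => by simp⟩
  let A : Subalgebra ℝ C(Q, ℝ) := (integralSpan φ Real.cos Q).toSubalgebra hone
    fun u v hu hv => mul_mem_integralSpan_cos hnrm hp hφ hu hv
  have hsep : A.SeparatesPoints := by
    intro μ ν hμν
    obtain ⟨f, hf, hne⟩ : ∃ f ∈ ridgeSpan φ k,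
        ∫ x, f x ∂μ.1.toMeasure ≠ ∫ x, f x ∂ν.1.toMeasure := by
      by_contra hcon
      push Not at hcon
      exact hμν (Subtype.ext (WassersteinSpace.eq_of_forall_mem_ridgeSpan hnrm hp hφ hna hcon))
    -- Normalize `f` so that its integrals against `ν` and `μ` are `0` and `π`.
    set d : ℝ := ∫ x, f x ∂μ.1.toMeasure - ∫ x, f x ∂ν.1.toMeasure with hd
    have hd0 : d ≠ 0 := sub_ne_zero.2 hne
    set f' : (Fin k → ℝ) → ℝ :=
      (Real.pi / d) • (f - fun _ => ∫ x, f x ∂ν.1.toMeasure) with hf'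
    have hf'mem : f' ∈ ridgeSpan φ k :=
      Submodule.smul_mem _ _ (sub_mem hf (const_mem_ridgeSpan hφ0 k _))
    obtain ⟨C, hC⟩ := exists_lipschitzWith_of_mem_ridgeSpan hφ hf
    obtain ⟨C', hC'⟩ := exists_lipschitzWith_of_mem_ridgeSpan hφ hf'mem
    have hval : ∀ η : WassersteinSpace nrm p, ∫ x, f' x ∂η.toMeasure
        = Real.pi / d * (∫ x, f x ∂η.toMeasure - ∫ x, f x ∂ν.1.toMeasure) := fun η => by
      simp only [hf', Pi.smul_apply, Pi.sub_apply, smul_eq_mul]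
      rw [integral_const_mul, integral_sub
        (WassersteinSpace.integrable_of_lipschitzWith hnrm hp hC η) (integrable_const _)]
      simp
    let g : C(Q, ℝ) := ⟨fun μ : Q => Real.cos (∫ x, f' x ∂μ.1.toMeasure), Real.continuous_cos.comp
      ((WassersteinSpace.continuous_integral hnrm hp hC').comp continuous_subtype_val)⟩
    have hg : g ∈ A := Submodule.subset_span ⟨f', hf'mem, fun _ => rfl⟩
    refine ⟨g, ⟨g, hg, rfl⟩, ?_⟩
    have h1 : g μ = -1 := by
      change Real.cos (∫ x, f' x ∂μ.1.toMeasure) = -1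
      rw [hval, ← hd, div_mul_cancel₀ _ hd0, Real.cos_pi]
    have h2 : g ν = 1 := by
      change Real.cos (∫ x, f' x ∂ν.1.toMeasure) = 1
      rw [hval, sub_self, mul_zero, Real.cos_zero]
    rw [h1, h2]
    norm_num
  have htop := ContinuousMap.subalgebra_topologicalClosure_eq_top_of_separatesPoints A hsep
  refine Submodule.dense_iff_topologicalClosure_eq_top.1 fun f => ?_
  have hf : f ∈ A.topologicalClosure := htop ▸ Algebra.mem_top
  exact hf

lemma exists_mem_integralSpan_comp (hnrm : ∀ x, nrm x = 0 → x = 0) (hp : 1 ≤ p) {φ : ℝ → ℝ}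
    {K : ℝ≥0} (hφ : LipschitzWith K φ) (hφ0 : ∃ t, φ t ≠ 0) (Q : Set (WassersteinSpace nrm p))
    {f : (Fin k → ℝ) → ℝ} (hf : f ∈ ridgeSpan φ k) {g : ℝ → ℝ} (hg : g ∈ dilationSpan φ) :
    ∃ G ∈ integralSpan φ φ Q, ∀ μ : Q, G μ = g (∫ x, f x ∂μ.1.toMeasure) := by
  induction hg using Submodule.span_induction with
  | mem g h =>
    obtain ⟨⟨a, b⟩, rfl⟩ := h
    have hmem : (a • f + fun _ => b) ∈ ridgeSpan φ k :=
      add_mem (Submodule.smul_mem _ _ hf) (const_mem_ridgeSpan hφ0 k b)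
    obtain ⟨C, hC⟩ := exists_lipschitzWith_of_mem_ridgeSpan hφ hf
    obtain ⟨C', hC'⟩ := exists_lipschitzWith_of_mem_ridgeSpan hφ hmem
    refine ⟨⟨fun μ : Q => φ (∫ x, (a • f + fun _ => b : (Fin k → ℝ) → ℝ) x ∂μ.1.toMeasure),
      hφ.continuous.comp
        ((WassersteinSpace.continuous_integral hnrm hp hC').comp continuous_subtype_val)⟩,
      Submodule.subset_span ⟨_, hmem, fun _ => rfl⟩, fun μ => ?_⟩
    change φ (∫ x, (a * f x + b) ∂μ.1.toMeasure) = _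
    rw [integral_add ((WassersteinSpace.integrable_of_lipschitzWith hnrm hp hC μ.1).const_mul a)
      (integrable_const _), integral_const_mul]
    simp
  | zero => exact ⟨0, Submodule.zero_mem _, fun _ => rfl⟩
  | add x y _ _ hx hy =>
    obtain ⟨G, hG, hG'⟩ := hx
    obtain ⟨H, hH, hH'⟩ := hy
    exact ⟨G + H, add_mem hG hH, fun μ => by simp [hG', hH']⟩
  | smul c x _ hx =>
    obtain ⟨G, hG, hG'⟩ := hx
    exact ⟨c • G, Submodule.smul_mem _ _ hG, fun μ => by simp [hG']⟩

/-- On the bounded range of `μ ↦ ∫ f dμ`, approximation with linear weight is uniform, so that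
cosines can be replaced by `φ`. -/
lemma topologicalClosure_integralSpan (hnrm : ∀ x, nrm x = 0 → x = 0) (hp : 1 ≤ p)
    {φ : ℝ → ℝ} {K : ℝ≥0} (hφ : LipschitzWith K φ) (hna : ¬ ∃ c d, ∀ t, φ t = c * t + d)
    (hφ0 : ∃ t, φ t ≠ 0) (Q : Set (WassersteinSpace nrm p)) [CompactSpace Q] :
    (integralSpan φ φ Q).topologicalClosure = ⊤ := by
  rw [eq_top_iff, ← topologicalClosure_integralSpan_cos hnrm hp hφ hna hφ0 Q]
  refine Submodule.topologicalClosure_minimal _ (Submodule.span_le.2 ?_)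
    (Submodule.isClosed_topologicalClosure _)
  rintro u ⟨f, hf, hu⟩
  obtain ⟨C, hC⟩ := exists_lipschitzWith_of_mem_ridgeSpan hφ hf
  let ℓ : C(Q, ℝ) := ⟨fun μ : Q => ∫ x, f x ∂μ.1.toMeasure,
    (WassersteinSpace.continuous_integral hnrm hp hC).comp continuous_subtype_val⟩
  refine Metric.mem_closure_iff.2 fun ε hε => ?_
  obtain ⟨g, hg, hgε⟩ := mem_weightedClosure.1 (cos_mem_weightedClosure hφ hna 1 0)
    (ε / (2 * (1 + ‖ℓ‖))) (by positivity)
  obtain ⟨G, hG, hG'⟩ := exists_mem_integralSpan_comp hnrm hp hφ hφ0 Q hf hg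
  refine ⟨G, hG, lt_of_le_of_lt ((ContinuousMap.dist_le (by positivity)).2 fun μ => ?_)
    (half_lt_self hε)⟩
  rw [Real.dist_eq, hu, hG']
  have h1 := hgε (ℓ μ)
  have h2 : |ℓ μ| ≤ ‖ℓ‖ := ℓ.norm_coe_le_norm μ
  rw [one_mul, add_zero] at h1
  calc |Real.cos (ℓ μ) - g (ℓ μ)| ≤ ε / (2 * (1 + ‖ℓ‖)) * (1 + |ℓ μ|) := h1
    _ ≤ ε / (2 * (1 + ‖ℓ‖)) * (1 + ‖ℓ‖) := by gcongr
    _ = ε / 2 := by field_simp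

end Density

theorem mainTheorem2 {k : ℕ} (nrm : Seminorm ℝ (Fin k → ℝ)) (hnrm : ∀ x, nrm x = 0 → x = 0)
    (p : ℝ) (hp : 1 ≤ p) (φ : ℝ → ℝ) (hLip : ∃ K : ℝ≥0, LipschitzWith K φ)
    (hpoly : ¬ ∃ P : Polynomial ℝ, ∀ t, φ t = P.eval t) (hasymp : AsymptoticallyPolynomial φ)
    (Q : Set (WassersteinSpace nrm p)) (hQ : IsCompact Q) :
    (∀ (r : ℕ), ∀ ρ ∈ NN φ r k, ∀ μ ∈ Q, Integrable ρ μ.toMeasure) ∧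
    (∀ F ∈ normalizedDeepSetsClass φ nrm p, ContinuousOn F Q) ∧
    Dense {f : C(Q, ℝ) | ∃ F ∈ normalizedDeepSetsClass φ nrm p, ∀ μ : Q, f μ = F μ} := by
  obtain ⟨K, hφ⟩ := hLip
  have hna : ¬ ∃ c d, ∀ t, φ t = c * t + d := fun ⟨c, d, h⟩ =>
    hpoly ⟨Polynomial.C c * Polynomial.X + Polynomial.C d, fun t => by simp [h]⟩
  have hφ0 : ∃ t, φ t ≠ 0 := by
    by_contra hcon
    push Not at hcon
    exact hpoly ⟨0, fun t => by simp [hcon]⟩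
  refine ⟨fun r ρ hρ μ _ => integrable_of_mem_NN hnrm hp hφ hφ0 hρ μ,
    fun F hF => (continuous_of_mem_normalizedDeepSetsClass hnrm hp hφ hφ0 hF).continuousOn, ?_⟩
  have : CompactSpace Q := isCompact_iff_compactSpace.1 hQ
  refine (Submodule.dense_iff_topologicalClosure_eq_top.2
    (topologicalClosure_integralSpan hnrm hp hφ hna hφ0 Q)).mono fun g hg => ?_
  suffices h : ∃ F ∈ Submodule.span ℝ (Set.range fun (f : ridgeSpan φ k)
      (μ : WassersteinSpace nrm p) => φ (∫ x, f.1 x ∂μ.toMeasure)), ∀ μ : Q, g μ = F μ by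
    obtain ⟨F, hF, hgF⟩ := h
    exact ⟨F, mem_normalizedDeepSetsClass_of_mem_span hnrm hp hφ hF, hgF⟩
  induction hg using Submodule.span_induction with
  | mem g h =>
    obtain ⟨f, hf, hg⟩ := h
    exact ⟨_, Submodule.subset_span ⟨⟨f, hf⟩, rfl⟩, hg⟩
  | zero => exact ⟨0, Submodule.zero_mem _, fun _ => rfl⟩
  | add u v _ _ hu hv =>
    obtain ⟨F, hF, h⟩ := hu
    obtain ⟨F', hF', h'⟩ := hv
    exact ⟨F + F', add_mem hF hF', fun μ => by simp [h, h']⟩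
  | smul c u _ hu =>
    obtain ⟨F, hF, h⟩ := hu
    exact ⟨c • F, Submodule.smul_mem _ c hF, fun μ => by simp [h]⟩
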